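/- Let $\mathcal L^-$ be the language given by $$\varphi ::= p^l_i \mid p^r_i \mid \neg\varphi \mid \varphi\wedge\varphi \mid \Box\varphi \mid \blacksquare\varphi \qquad (i\in\mathbb N),$$ where the $p^l_i$ and the $p^r_i$ are two disjoint countable families of propositional variables. A model $\mathfrak M=(W,R,V)$ consists of a non-empty set $W$, a binary relation $R\subseteq W\times W$ and a valuation $V$ that assigns a subset of $W$ to each propositional variable. Truth at a pair of states $s,t\in W$ is defined by: $\mathfrak M,s,t\models p^l_i$ iff $s\in V(p^l_i)$; $\mathfrak M,s,t\models p^r_i$ iff $t\in V(p^r_i)$; the usual clauses for $\neg$ and $\wedge$; $\mathfrak M,s,t\models\Box\varphi$ iff $\mathfrak M,s',t\models\varphi$ for all $s'$ with $Rss'$; and $\mathfrak M,s,t\models\blacksquare\varphi$ iff $\mathfrak M,s,t'\models\varphi$ for all $t'$ with $Rtt'$. A formula is satisfiable if it is true at some pair of states of some model, and valid if it is true at all pairs of states of all models; $\mathsf{LHS}^-$ is the set of valid formulas of $\mathcal L^-$. Theorem. $\mathsf{LHS}^-$ has the finite model property: every satisfiable formula of $\mathcal L^-$ is true at some pair of states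 of some model with finite $W$, and, equivalently, every formula of $\mathcal L^-$ that is not valid is false at some pair of states of some model with finite $W$. Moreover, $\mathsf{LHS}^-$ is decidable: there is an algorithm that decides whether a given formula of $\mathcal L^-$ is satisfiable, and an algorithm that decides whether a given formula of $\mathcal L^-$ is valid. -/

import Mathlib

universe u

namespace LHSMinus

/-- Formulas of the language of `LHS⁻`: propositional variables `p^l_i` and `p^r_i` of the two
(disjoint, countable) kinds, negation, conjunction, the white box `□` and the black box `■`;
there is no equality constant. -/
inductive Formula : Type
  | pl : ℕ → Formula
  | pr : ℕ → Formula
  | neg : Formula → Formula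
  | and : Formula → Formula → Formula
  | wbox : Formula → Formula
  | bbox : Formula → Formula

namespace Formula

/-- The Gödel number of a formula. -/
def toNat : Formula → ℕ
  | pl i => 6 * i
  | pr i => 6 * i + 1
  | neg φ => 6 * φ.toNat + 2
  | and φ ψ => 6 * Nat.pair φ.toNat ψ.toNat + 3
  | wbox φ => 6 * φ.toNat + 4
  | bbox φ => 6 * φ.toNat + 5

/-- The formula with a given Gödel number. -/
def ofNat (n : ℕ) : Formula :=
  if n % 6 = 0 then pl (n / 6)
  else if n % 6 = 1 then pr (n / 6)
  else if n % 6 = 2 then neg (ofNat (n / 6))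
  else if n % 6 = 3 then and (ofNat (n / 6).unpair.1) (ofNat (n / 6).unpair.2)
  else if n % 6 = 4 then wbox (ofNat (n / 6))
  else bbox (ofNat (n / 6))
termination_by n
decreasing_by
  · omega
  · have := Nat.unpair_left_le (n / 6); omega
  · have := Nat.unpair_right_le (n / 6); omega
  · omega
  · omega

theorem ofNat_toNat (φ : Formula) : ofNat φ.toNat = φ := by
  induction φ with
  | pl i => rw [toNat, ofNat]; simp
  | pr i =>
    rw [toNat, ofNat]
    have h1 : (6 * i + 1) % 6 = 1 := by omega
    have h2 : (6 * i + 1) / 6 = i := by omega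
    simp [h1, h2]
  | neg φ ih =>
    rw [toNat, ofNat]
    have h1 : (6 * φ.toNat + 2) % 6 = 2 := by omega
    have h2 : (6 * φ.toNat + 2) / 6 = φ.toNat := by omega
    simp [h1, h2, ih]
  | and φ ψ ih1 ih2 =>
    rw [toNat, ofNat]
    have h1 : (6 * Nat.pair φ.toNat ψ.toNat + 3) % 6 = 3 := by omega
    have h2 : (6 * Nat.pair φ.toNat ψ.toNat + 3) / 6 = Nat.pair φ.toNat ψ.toNat := by omega
    simp [h1, h2, ih1, ih2]
  | wbox φ ih =>
    rw [toNat, ofNat]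
    have h1 : (6 * φ.toNat + 4) % 6 = 4 := by omega
    have h2 : (6 * φ.toNat + 4) / 6 = φ.toNat := by omega
    simp [h1, h2, ih]
  | bbox φ ih =>
    rw [toNat, ofNat]
    have h1 : (6 * φ.toNat + 5) % 6 = 5 := by omega
    have h2 : (6 * φ.toNat + 5) / 6 = φ.toNat := by omega
    simp [h1, h2, ih]

theorem toNat_ofNat (n : ℕ) : (ofNat n).toNat = n := by
  induction n using Nat.strong_induction_on with
  | _ n ih =>
    rw [ofNat]
    split_ifs with h0 h1 h2 h3 h4
    · rw [toNat]; omega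
    · rw [toNat]; omega
    · rw [toNat, ih _ (by omega)]; omega
    · have hl := Nat.unpair_left_le (n / 6)
      have hr := Nat.unpair_right_le (n / 6)
      rw [toNat, ih _ (by omega), ih _ (by omega), Nat.pair_unpair]; omega
    · rw [toNat, ih _ (by omega)]; omega
    · rw [toNat, ih _ (by omega)]; omega

/-- The Gödel numbering as a bijection between formulas and natural numbers. -/
def equivNat : Formula ≃ ℕ where
  toFun := toNat
  invFun := ofNat
  left_inv := ofNat_toNat
  right_inv := toNat_ofNat

/-- Computability of sets of formulas (`ComputablePred`) refers to the Gödel numbering above. -/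
instance : Primcodable Formula := Primcodable.ofEquiv ℕ equivNat

end Formula

/-- A model: a nonempty set of states, a binary relation, and a valuation of the variables
`p^l_i` (written `Sum.inl i`) and `p^r_i` (written `Sum.inr i`) as sets of states. -/
structure Model : Type (u + 1) where
  W : Type u
  nonempty : Nonempty W
  R : W → W → Prop
  V : ℕ ⊕ ℕ → Set W

/-- Truth of a formula at a pair of states. -/
def Model.Truth (M : Model.{u}) : M.W → M.W → Formula → Prop
  | s, _, .pl i => s ∈ M.V (Sum.inl i)
  | _, t, .pr i => t ∈ M.V (Sum.inr i)
  | s, t, .neg φ => ¬ M.Truth s t φ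
  | s, t, .and φ ψ => M.Truth s t φ ∧ M.Truth s t ψ
  | s, t, .wbox φ => ∀ s', M.R s s' → M.Truth s' t φ
  | s, t, .bbox φ => ∀ t', M.R t t' → M.Truth s t' φ

/-- `φ` is true at some pair of states of some model. -/
def Satisfiable (φ : Formula) : Prop :=
  ∃ (M : Model.{u}) (s t : M.W), M.Truth s t φ

/-- `φ` is true at all pairs of states of all models. -/
def Valid (φ : Formula) : Prop :=
  ∀ (M : Model.{u}) (s t : M.W), M.Truth s t φ

end LHSMinus

/-
Truth of a formula at a pair of states depends on each state only up to a bisimulation of bounded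
depth for finitely many variables. A state of any model is bisimilar in this sense to a hereditarily
finite one, coded by a natural number that packs the bit mask of its variables with the bit mask of
the codes of its successors. All formulas are therefore interpreted in a single model on `ℕ`, where
successors are smaller than their predecessors: the states up to a given one form a finite generated
submodel, and truth can be computed by labelling the pairs of states with the subformulas true
there. An explicit bound on the codes makes the search for a satisfying pair finite.
-/

universe v

namespace LHSMinus

open Encodable

namespace Formula

/-- The set of propositional variables of a formula, encoded as in `Model.V`. -/
def vars : Formula → Set (ℕ ⊕ ℕ)
  | pl i => {Sum.inl i}
  | pr i => {Sum.inr i}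
  | neg φ => φ.vars
  | and φ ψ => φ.vars ∪ ψ.vars
  | wbox φ => φ.vars
  | bbox φ => φ.vars

/-- The modal depth, where the boxes of both colours count alike. -/
def depth : Formula → ℕ
  | pl _ => 0
  | pr _ => 0
  | neg φ => φ.depth
  | and φ ψ => max φ.depth ψ.depth
  | wbox φ => φ.depth + 1
  | bbox φ => φ.depth + 1

theorem encode_le_toNat_of_mem_vars {φ : Formula} {p : ℕ ⊕ ℕ} (hp : p ∈ φ.vars) :
    encode p ≤ φ.toNat := by
  induction φ with
  | pl i =>
    obtain rfl : p = Sum.inl i := hp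
    rw [encode_inl, encode_nat, toNat]
    omega
  | pr i =>
    obtain rfl : p = Sum.inr i := hp
    rw [encode_inr, encode_nat, toNat]
    omega
  | and φ ψ ihφ ihψ =>
    have hφ := Nat.left_le_pair φ.toNat ψ.toNat
    have hψ := Nat.right_le_pair φ.toNat ψ.toNat
    rw [toNat]
    rcases hp with hp | hp
    · have := ihφ hp
      omega
    · have := ihψ hp
      omega
  | neg φ ih | wbox φ ih | bbox φ ih =>
    have := ih hp
    rw [toNat]
    omega

theorem depth_le_toNat (φ : Formula) : φ.depth ≤ φ.toNat := by
  induction φ with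
  | pl i | pr i => exact Nat.zero_le _
  | and φ ψ ihφ ihψ =>
    have hφ := Nat.left_le_pair φ.toNat ψ.toNat
    have hψ := Nat.right_le_pair φ.toNat ψ.toNat
    rw [depth, toNat]
    omega
  | neg φ ih | wbox φ ih | bbox φ ih =>
    rw [depth, toNat]
    omega

end Formula

section Bisimulation

variable {M : Model.{u}} {N : Model.{v}} {P : Set (ℕ ⊕ ℕ)}

/-- Bisimilarity up to depth `k` with respect to the variables in `P`, between single states. -/
def Bisimilar (M : Model.{u}) (N : Model.{v}) (P : Set (ℕ ⊕ ℕ)) : ℕ → M.W → N.W → Prop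
  | 0, s, t => ∀ p ∈ P, s ∈ M.V p ↔ t ∈ N.V p
  | k + 1, s, t => (∀ p ∈ P, s ∈ M.V p ↔ t ∈ N.V p) ∧
      (∀ s', M.R s s' → ∃ t', N.R t t' ∧ Bisimilar M N P k s' t') ∧
      ∀ t', N.R t t' → ∃ s', M.R s s' ∧ Bisimilar M N P k s' t'

theorem Bisimilar.mem_V_iff {k : ℕ} {s : M.W} {t : N.W} (h : Bisimilar M N P k s t)
    {p : ℕ ⊕ ℕ} (hp : p ∈ P) : s ∈ M.V p ↔ t ∈ N.V p := by
  cases k with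
  | zero => exact h p hp
  | succ k => exact h.1 p hp

theorem Bisimilar.forall_R_iff {k : ℕ} {s : M.W} {t : N.W} (h : Bisimilar M N P (k + 1) s t)
    {A : M.W → Prop} {B : N.W → Prop} (hAB : ∀ s' t', Bisimilar M N P k s' t' → (A s' ↔ B t')) :
    (∀ s', M.R s s' → A s') ↔ ∀ t', N.R t t' → B t' := by
  obtain ⟨-, forth, back⟩ := h
  constructor
  · intro hA t' ht'
    obtain ⟨s', hs', h'⟩ := back t' ht'
    exact (hAB s' t' h').1 (hA s' hs')
  · intro hB s' hs'
    obtain ⟨t', ht', h'⟩ := forth s' hs'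
    exact (hAB s' t' h').2 (hB t' ht')

theorem truth_iff_of_bisimilar {φ : Formula} (hP : φ.vars ⊆ P) {j k : ℕ} (hj : φ.depth ≤ j)
    (hk : φ.depth ≤ k) {s₁ t₁ : M.W} {s₂ t₂ : N.W} (hs : Bisimilar M N P j s₁ s₂)
    (ht : Bisimilar M N P k t₁ t₂) : M.Truth s₁ t₁ φ ↔ N.Truth s₂ t₂ φ := by
  induction φ generalizing j k s₁ t₁ s₂ t₂ with
  | pl i => exact hs.mem_V_iff (hP rfl)
  | pr i => exact ht.mem_V_iff (hP rfl)
  | neg φ ih => exact not_congr (ih hP hj hk hs ht)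
  | and φ ψ ihφ ihψ =>
    obtain ⟨hφ, hψ⟩ := Set.union_subset_iff.1 hP
    obtain ⟨hφj, hψj⟩ := max_le_iff.1 hj
    obtain ⟨hφk, hψk⟩ := max_le_iff.1 hk
    exact and_congr (ihφ hφ hφj hφk hs ht) (ihψ hψ hψj hψk hs ht)
  | wbox φ ih =>
    obtain ⟨j, rfl⟩ := Nat.exists_eq_add_of_le' (Nat.le_of_add_left_le hj)
    exact hs.forall_R_iff fun _ _ hs' =>
      ih hP (Nat.le_of_succ_le_succ hj) (Nat.le_of_succ_le hk) hs' ht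
  | bbox φ ih =>
    obtain ⟨k, rfl⟩ := Nat.exists_eq_add_of_le' (Nat.le_of_add_left_le hk)
    exact ht.forall_R_iff fun _ _ ht' =>
      ih hP (Nat.le_of_succ_le hj) (Nat.le_of_succ_le_succ hk) hs ht'

end Bisimulation

section Restrict

variable {M : Model.{v}} {S : Set M.W} [Nonempty S]

/-- The submodel on a nonempty set of states, lifted to a larger universe. -/
def Model.restrict (M : Model.{v}) (S : Set M.W) [Nonempty S] : Model.{max u v} where
  W := ULift.{u} S
  nonempty := inferInstance
  R s t := M.R s.down t.down
  V p := {s | (s.down : M.W) ∈ M.V p}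

theorem bisimilar_restrict (hS : ∀ s ∈ S, ∀ t, M.R s t → t ∈ S) (P : Set (ℕ ⊕ ℕ)) (k : ℕ)
    (s : (Model.restrict.{u} M S).W) : Bisimilar (Model.restrict.{u} M S) M P k s s.down := by
  induction k generalizing s with
  | zero => exact fun _ _ => Iff.rfl
  | succ k ih =>
    exact ⟨fun _ _ => Iff.rfl, fun s' hs' => ⟨s'.down, hs', ih s'⟩, fun t ht =>
      ⟨⟨t, hS _ s.down.2 t ht⟩, ht, ih _⟩⟩

theorem truth_restrict_iff (hS : ∀ s ∈ S, ∀ t, M.R s t → t ∈ S) {φ : Formula}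
    {s t : (Model.restrict.{u} M S).W} :
    (Model.restrict.{u} M S).Truth s t φ ↔ M.Truth s.down t.down φ :=
  truth_iff_of_bisimilar subset_rfl le_rfl le_rfl (bisimilar_restrict hS φ.vars φ.depth s)
    (bisimilar_restrict hS φ.vars φ.depth t)

end Restrict

section ModelOnNat

variable {R : ℕ → ℕ → Prop} {V : ℕ ⊕ ℕ → Set ℕ}

/-- The model on the natural numbers with a given relation and valuation. -/
abbrev natModel (R : ℕ → ℕ → Prop) (V : ℕ ⊕ ℕ → Set ℕ) : Model.{0} where
  W := ℕ
  nonempty := inferInstance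
  R := R
  V := V

theorem exists_finite_of_natModel_truth (hR : ∀ s s', R s s' → s' < s) {φ : Formula} {s t : ℕ}
    (h : (natModel R V).Truth s t φ) :
    ∃ (M : Model.{u}) (s t : M.W), Finite M.W ∧ M.Truth s t φ := by
  have : Nonempty (Set.Iic (max s t)) := ⟨⟨s, le_max_left s t⟩⟩
  have hclosed (x) (hx : x ∈ Set.Iic (max s t)) (y) (hxy : R x y) : y ∈ Set.Iic (max s t) :=
    (hR x y hxy).le.trans hx
  exact ⟨(natModel R V).restrict (Set.Iic (max s t)), ⟨s, le_max_left s t⟩, ⟨t, le_max_right s t⟩,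
    inferInstanceAs (Finite (ULift (Set.Iic (max s t)))), (truth_restrict_iff hclosed).2 h⟩

end ModelOnNat

/-- The relation of the universal model: the second component of a state, read as a bit mask, is the
set of its successors. -/
def codeRel (s s' : ℕ) : Prop := s.unpair.2.testBit s' = true

/-- The valuation of the universal model: the first component of a state, read as a bit mask, is the
set of the variables true at it. -/
def codeVal (p : ℕ ⊕ ℕ) : Set ℕ := {s | s.unpair.1.testBit (encode p) = true}

theorem lt_of_codeRel (s s' : ℕ) (h : codeRel s s') : s' < s :=
  calc s' < 2 ^ s' := Nat.lt_two_pow_self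
    _ ≤ s.unpair.2 := Nat.ge_two_pow_of_testBit h
    _ ≤ s := Nat.unpair_right_le s

theorem exists_lt_two_pow_testBit_iff (n : ℕ) (A : ℕ → Prop) :
    ∃ m < 2 ^ n, ∀ i, m.testBit i = true ↔ i < n ∧ A i := by
  classical
  refine ⟨Nat.ofBits fun i : Fin n => decide (A i), Nat.ofBits_lt_two_pow _, fun i => ?_⟩
  simp [Nat.testBit_ofBits]

theorem exists_code (n : ℕ) (A : ℕ ⊕ ℕ → Prop) (B : ℕ → Prop) : ∃ c < 4 ^ n,
    (∀ p, c ∈ codeVal p ↔ encode p < n ∧ A p) ∧ ∀ d, codeRel c d ↔ d < n ∧ B d := by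
  obtain ⟨a, ha, hA⟩ := exists_lt_two_pow_testBit_iff n fun i => ∃ p, encode p = i ∧ A p
  obtain ⟨b, hb, hB⟩ := exists_lt_two_pow_testBit_iff n B
  refine ⟨Nat.pair a b, ?_, fun p => by simp [codeVal, hA], fun d => by simp [codeRel, hB]⟩
  calc Nat.pair a b < (max a b + 1) ^ 2 := Nat.pair_lt_max_add_one_sq a b
    _ ≤ (2 ^ n) ^ 2 := Nat.pow_le_pow_left (max_lt ha hb) 2
    _ = 4 ^ n := by rw [pow_right_comm]; norm_num

theorem exists_bisimilar_code (M : Model.{u}) (n k : ℕ) (s : M.W) :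
    ∃ c < (4 ^ ·)^[k + 1] n, Bisimilar M (natModel codeRel codeVal) {p | encode p < n} k s c := by
  have hle (k : ℕ) : n ≤ (4 ^ ·)^[k] n :=
    Function.id_le_iterate_of_id_le (fun m => (Nat.lt_pow_self (by norm_num)).le) k n
  induction k generalizing s with
  | zero =>
    obtain ⟨c, hc, hV, -⟩ := exists_code n (s ∈ M.V ·) fun _ => False
    exact ⟨c, hc, fun p hp => ((hV p).trans (and_iff_right hp)).symm⟩
  | succ k ih =>
    obtain ⟨c, hc, hV, hR⟩ := exists_code ((4 ^ ·)^[k + 1] n) (s ∈ M.V ·)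
      fun d => ∃ s', M.R s s' ∧ Bisimilar M (natModel codeRel codeVal) {p | encode p < n} k s' d
    rw [← Function.iterate_succ_apply' (4 ^ ·)] at hc
    refine ⟨c, hc, fun p hp => ((hV p).trans (and_iff_right (hp.trans_le (hle _)))).symm,
      fun s' hs' => ?_, fun d hd => ((hR d).1 hd).2⟩
    obtain ⟨d, hd, hbisim⟩ := ih s'
    exact ⟨d, (hR d).2 ⟨hd, s', hs', hbisim⟩, hbisim⟩

theorem Satisfiable.exists_code_lt {φ : Formula} (h : Satisfiable.{u} φ) :
    ∃ s < (4 ^ ·)^[φ.toNat + 1] (φ.toNat + 1), ∃ t < (4 ^ ·)^[φ.toNat + 1] (φ.toNat + 1),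
      (natModel codeRel codeVal).Truth s t φ := by
  obtain ⟨M, s, t, h⟩ := h
  obtain ⟨c, hc, hsc⟩ := exists_bisimilar_code M (φ.toNat + 1) φ.toNat s
  obtain ⟨d, hd, htd⟩ := exists_bisimilar_code M (φ.toNat + 1) φ.toNat t
  have hvars : φ.vars ⊆ {p | encode p < φ.toNat + 1} :=
    fun _ hp => Nat.lt_succ_of_le (Formula.encode_le_toNat_of_mem_vars hp)
  exact ⟨c, hc, d, hd,
    (truth_iff_of_bisimilar hvars φ.depth_le_toNat φ.depth_le_toNat hsc htd).1 h⟩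

theorem Satisfiable.exists_finite {φ : Formula} (h : Satisfiable.{u} φ) :
    ∃ (M : Model.{u}) (s t : M.W), Finite M.W ∧ M.Truth s t φ := by
  obtain ⟨s, -, t, -, hst⟩ := h.exists_code_lt
  exact exists_finite_of_natModel_truth lt_of_codeRel hst

theorem satisfiable_neg_iff {φ : Formula} : Satisfiable.{u} φ.neg ↔ ¬ Valid.{u} φ := by
  simp only [Satisfiable, Valid, Model.Truth, not_forall]

theorem exists_finite_of_not_valid {φ : Formula} (h : ¬ Valid.{u} φ) :
    ∃ (M : Model.{u}) (s t : M.W), Finite M.W ∧ ¬ M.Truth s t φ :=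
  (satisfiable_neg_iff.2 h).exists_finite

namespace Formula

theorem primrec_toNat : Primrec toNat :=
  Primrec.of_equiv (e := equivNat)

theorem primrec_neg : Primrec neg :=
  (Primrec.of_equiv_iff equivNat).1 <|
    Primrec.nat_add.comp (Primrec.nat_mul.comp (Primrec.const 6) primrec_toNat) (Primrec.const 2)

section Fold

variable {α σ : Type*} {fpl fpr : α → ℕ → σ} {fneg fwbox fbbox : α → σ → σ} {fand : α → σ → σ → σ}

/-- Evaluation of a formula in an algebra of the signature of the language: the value is computed
from the values of the immediate subformulas. -/
def fold (gpl gpr : ℕ → σ) (gneg : σ → σ) (gand : σ → σ → σ) (gwbox gbbox : σ → σ) : Formula → σ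
  | pl i => gpl i
  | pr i => gpr i
  | neg φ => gneg (φ.fold gpl gpr gneg gand gwbox gbbox)
  | and φ ψ => gand (φ.fold gpl gpr gneg gand gwbox gbbox) (ψ.fold gpl gpr gneg gand gwbox gbbox)
  | wbox φ => gwbox (φ.fold gpl gpr gneg gand gwbox gbbox)
  | bbox φ => gbbox (φ.fold gpl gpr gneg gand gwbox gbbox)

/-- One step of the evaluation of `Formula.fold` by course-of-values recursion on the Gödel number:
`l` lists the values of the formulas with smaller Gödel number than the current one, which is the
length of `l`. -/
def foldStep (gpl gpr : ℕ → σ) (gneg : σ → σ) (gand : σ → σ → σ) (gwbox gbbox : σ → σ)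
    (l : List σ) : Option σ :=
  if l.length % 6 = 0 then some (gpl (l.length / 6))
  else if l.length % 6 = 1 then some (gpr (l.length / 6))
  else if l.length % 6 = 2 then l[l.length / 6]?.map gneg
  else if l.length % 6 = 3 then
    l[(l.length / 6).unpair.1]?.bind fun x => l[(l.length / 6).unpair.2]?.map (gand x)
  else if l.length % 6 = 4 then l[l.length / 6]?.map gwbox
  else l[l.length / 6]?.map gbbox

theorem foldStep_map_range (gpl gpr : ℕ → σ) (gneg : σ → σ) (gand : σ → σ → σ)
    (gwbox gbbox : σ → σ) (φ : Formula) :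
    foldStep gpl gpr gneg gand gwbox gbbox ((List.range φ.toNat).map fun n =>
      (ofNat n).fold gpl gpr gneg gand gwbox gbbox) =
    some (φ.fold gpl gpr gneg gand gwbox gbbox) := by
  have hget {ψ : Formula} (hψ : ψ.toNat < φ.toNat) :
      ((List.range φ.toNat).map fun n => (ofNat n).fold gpl gpr gneg gand gwbox gbbox)[ψ.toNat]? =
        some (ψ.fold gpl gpr gneg gand gwbox gbbox) := by
    simp [hψ, ofNat_toNat]
  unfold foldStep
  rw [List.length_map, List.length_range]
  cases φ with
  | pl i | pr i => simp [toNat, fold, Nat.mul_add_div]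
  | and φ ψ =>
    have hφ := Nat.left_le_pair φ.toNat ψ.toNat
    have hψ := Nat.right_le_pair φ.toNat ψ.toNat
    have hdiv : (φ.and ψ).toNat / 6 = Nat.pair φ.toNat ψ.toNat := by rw [toNat]; omega
    have hmod : (φ.and ψ).toNat % 6 = 3 := by rw [toNat]; omega
    rw [hdiv, hmod, Nat.unpair_pair, hget (by rw [toNat]; omega), hget (by rw [toNat]; omega)]
    simp [fold]
  | neg φ | wbox φ | bbox φ =>
    rw [show _ / 6 = φ.toNat by rw [toNat]; omega, hget (by rw [toNat]; omega)]
    simp [toNat, fold]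

variable [Primcodable α] [Primcodable σ]

theorem primrec₂_foldStep (hpl : Primrec₂ fpl) (hpr : Primrec₂ fpr) (hneg : Primrec₂ fneg)
    (hand : Primrec₂ fun a (x : σ × σ) => fand a x.1 x.2) (hwbox : Primrec₂ fwbox)
    (hbbox : Primrec₂ fbbox) : Primrec₂ fun a =>
      foldStep (fpl a) (fpr a) (fneg a) (fand a) (fwbox a) (fbbox a) := by
  have hlength : Primrec fun x : α × List σ => x.2.length := Primrec.list_length.comp Primrec.snd
  have hmod (k : ℕ) : PrimrecPred fun x : α × List σ => x.2.length % 6 = k :=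
    Primrec.eq.comp (Primrec.nat_mod.comp hlength (Primrec.const 6)) (Primrec.const k)
  have hdiv : Primrec fun x : α × List σ => x.2.length / 6 :=
    Primrec.nat_div.comp hlength (Primrec.const 6)
  have hunpair : Primrec fun x : α × List σ => (x.2.length / 6).unpair := Primrec.unpair.comp hdiv
  have hget {i : α × List σ → ℕ} (hi : Primrec i) : Primrec fun x : α × List σ => x.2[i x]? :=
    Primrec.list_getElem?.comp Primrec.snd hi
  have hmap {f : α → σ → σ} (hf : Primrec₂ f) :
      Primrec fun x : α × List σ => x.2[x.2.length / 6]?.map (f x.1) :=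
    Primrec.option_map (hget hdiv) (hf.comp (Primrec.fst.comp Primrec.fst) Primrec.snd).to₂
  have hmap₂ : Primrec fun x : α × List σ => x.2[(x.2.length / 6).unpair.1]?.bind fun y =>
      x.2[(x.2.length / 6).unpair.2]?.map (fand x.1 y) :=
    Primrec.option_bind (hget (Primrec.fst.comp hunpair)) <| Primrec.to₂ <|
      Primrec.option_map ((hget (Primrec.snd.comp hunpair)).comp Primrec.fst) <| Primrec.to₂ <|
        hand.comp (Primrec.fst.comp (Primrec.fst.comp Primrec.fst))
          ((Primrec.snd.comp Primrec.fst).pair Primrec.snd)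
  exact Primrec.ite (hmod 0) (Primrec.option_some.comp (hpl.comp Primrec.fst hdiv)) <|
    Primrec.ite (hmod 1) (Primrec.option_some.comp (hpr.comp Primrec.fst hdiv)) <|
    Primrec.ite (hmod 2) (hmap hneg) <| Primrec.ite (hmod 3) hmap₂ <|
    Primrec.ite (hmod 4) (hmap hwbox) (hmap hbbox)

theorem primrec₂_fold (hpl : Primrec₂ fpl) (hpr : Primrec₂ fpr) (hneg : Primrec₂ fneg)
    (hand : Primrec₂ fun a (x : σ × σ) => fand a x.1 x.2) (hwbox : Primrec₂ fwbox)
    (hbbox : Primrec₂ fbbox) : Primrec₂ fun a =>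
      fold (fpl a) (fpr a) (fneg a) (fand a) (fwbox a) (fbbox a) := by
  have hfold : Primrec₂ fun a n =>
      (ofNat n).fold (fpl a) (fpr a) (fneg a) (fand a) (fwbox a) (fbbox a) :=
    Primrec.nat_strong_rec _ (primrec₂_foldStep hpl hpr hneg hand hwbox hbbox) fun a n => by
      simpa only [toNat_ofNat] using
        foldStep_map_range (fpl a) (fpr a) (fneg a) (fand a) (fwbox a) (fbbox a) (ofNat n)
  exact (hfold.comp Primrec.fst (primrec_toNat.comp Primrec.snd)).of_eq fun x => by
    rw [ofNat_toNat]

end Fold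

end Formula

theorem primrecRel_mem_list {α : Type*} [Primcodable α] :
    PrimrecRel fun (a : α) (l : List α) => a ∈ l :=
  (Primrec.eq.exists_mem_list.comp Primrec.snd Primrec.fst).of_eq fun _ => by
    rw [exists_eq_right]

section ModelChecking

variable {R : ℕ → ℕ → Prop} [DecidableRel R] {V : ℕ ⊕ ℕ → Set ℕ} [∀ p, DecidablePred (· ∈ V p)]

/-- The labelling algorithm: the list of the codes `Nat.pair s t < b` of the pairs of states of
`natModel R V` at which a formula is true, for a relation `R` that decreases states. -/
def labels (R : ℕ → ℕ → Prop) [DecidableRel R] (V : ℕ ⊕ ℕ → Set ℕ)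
    [∀ p, DecidablePred (· ∈ V p)] (b : ℕ) : Formula → List ℕ
  | .pl i => (List.range b).filter fun x => x.unpair.1 ∈ V (Sum.inl i)
  | .pr i => (List.range b).filter fun x => x.unpair.2 ∈ V (Sum.inr i)
  | .neg φ => (List.range b).filter (· ∉ labels R V b φ)
  | .and φ ψ => (List.range b).filter fun x => x ∈ labels R V b φ ∧ x ∈ labels R V b ψ
  | .wbox φ => (List.range b).filter fun x => ∀ s ∈ List.range x.unpair.1,
      R x.unpair.1 s → Nat.pair s x.unpair.2 ∈ labels R V b φ
  | .bbox φ => (List.range b).filter fun x => ∀ t ∈ List.range x.unpair.2,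
      R x.unpair.2 t → Nat.pair x.unpair.1 t ∈ labels R V b φ

theorem mem_labels_iff (hR : ∀ s s', R s s' → s' < s) {b : ℕ} {φ : Formula} {s t : ℕ} :
    Nat.pair s t ∈ labels R V b φ ↔ Nat.pair s t < b ∧ (natModel R V).Truth s t φ := by
  induction φ generalizing s t with
  | pl i | pr i => simp [labels, Model.Truth]
  | neg φ ih => simp +contextual [labels, Model.Truth, ih]
  | and φ ψ ihφ ihψ => simp +contextual [labels, Model.Truth, ihφ, ihψ]
  | wbox φ ih =>
    simp only [labels, Model.Truth, List.mem_filter, List.mem_range, Nat.unpair_pair,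
      decide_eq_true_eq, ih, and_congr_right_iff]
    refine fun hb => forall_congr' fun s' => ?_
    exact ⟨fun h hs' => (h (hR s s' hs') hs').2, fun h hlt hs' =>
      ⟨(Nat.pair_lt_pair_left t hlt).trans hb, h hs'⟩⟩
  | bbox φ ih =>
    simp only [labels, Model.Truth, List.mem_filter, List.mem_range, Nat.unpair_pair,
      decide_eq_true_eq, ih, and_congr_right_iff]
    refine fun hb => forall_congr' fun t' => ?_
    exact ⟨fun h ht' => (h (hR t t' ht') ht').2, fun h hlt ht' =>
      ⟨(Nat.pair_lt_pair_right s hlt).trans hb, h ht'⟩⟩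

theorem primrec₂_labels (hR : PrimrecRel R) (hV : PrimrecRel fun s p => s ∈ V p) :
    Primrec₂ (labels R V) := by
  have hfst : Primrec fun x : ℕ => x.unpair.1 := Primrec.fst.comp Primrec.unpair
  have hsnd : Primrec fun x : ℕ => x.unpair.2 := Primrec.snd.comp Primrec.unpair
  have hfilter {β : Type} [Primcodable β] {p : ℕ → β → Prop} [DecidableRel p] (hp : PrimrecRel p) :
      Primrec₂ fun b a => (List.range b).filter (p · a) :=
    hp.listFilter.comp (Primrec.list_range.comp Primrec.fst) Primrec.snd
  have hbox {f : ℕ → ℕ} {h : ℕ → ℕ → ℕ} (hf : Primrec f) (hh : Primrec₂ h) :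
      PrimrecRel fun (x : ℕ) (l : List ℕ) => ∀ s ∈ List.range (f x), R (f x) s → h s x ∈ l := by
    have : PrimrecRel fun (s : ℕ) (y : ℕ × List ℕ) => R (f y.1) s → h s y.1 ∈ y.2 :=
      ((hR.comp (hf.comp (Primrec.fst.comp Primrec.snd)) Primrec.fst).not.or
        (primrecRel_mem_list.comp (hh.comp Primrec.fst (Primrec.fst.comp Primrec.snd))
          (Primrec.snd.comp Primrec.snd))).of_eq fun _ => imp_iff_not_or.symm
    exact this.forall_mem_list.comp (Primrec.list_range.comp (hf.comp Primrec.fst)) Primrec.id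
  have hpl : PrimrecRel fun x i : ℕ => x.unpair.1 ∈ V (Sum.inl i) :=
    hV.comp (hfst.comp Primrec.fst) (Primrec.sumInl.comp Primrec.snd)
  have hpr : PrimrecRel fun x i : ℕ => x.unpair.2 ∈ V (Sum.inr i) :=
    hV.comp (hsnd.comp Primrec.fst) (Primrec.sumInr.comp Primrec.snd)
  have hand : PrimrecRel fun (x : ℕ) (l : List ℕ × List ℕ) => x ∈ l.1 ∧ x ∈ l.2 :=
    (primrecRel_mem_list.comp Primrec.fst (Primrec.fst.comp Primrec.snd)).and
      (primrecRel_mem_list.comp Primrec.fst (Primrec.snd.comp Primrec.snd))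
  have hwbox := hbox hfst (h := fun s x => Nat.pair s x.unpair.2)
    (Primrec₂.natPair.comp Primrec.fst (hsnd.comp Primrec.snd))
  have hbbox := hbox hsnd (h := fun t x => Nat.pair x.unpair.1 t)
    (Primrec₂.natPair.comp (hfst.comp Primrec.snd) Primrec.fst)
  refine (Formula.primrec₂_fold
    (fand := fun b l l' => (List.range b).filter fun x => x ∈ l ∧ x ∈ l')
    (hfilter hpl) (hfilter hpr) (hfilter primrecRel_mem_list.not) (hfilter hand) (hfilter hwbox)
    (hfilter hbbox)).of_eq fun b φ => ?_
  induction φ <;> simp only [Formula.fold, labels, *]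

end ModelChecking

theorem primrecRel_exists_truth {R : ℕ → ℕ → Prop} {V : ℕ ⊕ ℕ → Set ℕ} (hR : PrimrecRel R)
    (hlt : ∀ s s', R s s' → s' < s) (hV : PrimrecRel fun s p => s ∈ V p) :
    PrimrecRel fun (b : ℕ) (φ : Formula) =>
      ∃ s t, Nat.pair s t < b ∧ (natModel R V).Truth s t φ := by
  classical
  have hne : PrimrecRel fun b φ => labels R V b φ ≠ [] :=
    (Primrec.eq.comp (primrec₂_labels hR hV) (Primrec.const [])).not
  refine hne.of_eq fun b φ => ?_
  simp only [← mem_labels_iff hlt]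
  constructor
  · intro h
    obtain ⟨x, hx⟩ := List.exists_mem_of_ne_nil _ h
    exact ⟨x.unpair.1, x.unpair.2, by rwa [Nat.pair_unpair]⟩
  · rintro ⟨s, t, hst⟩
    exact List.ne_nil_of_mem hst

theorem primrecRel_testBit : PrimrecRel fun m i : ℕ => m.testBit i = true :=
  (Primrec.eq.comp (Primrec.nat_mod.comp (Primrec.nat_div.comp Primrec.fst
    ((Primrec₂.unpaired'.1 Nat.Primrec.pow).comp (Primrec.const 2) Primrec.snd))
    (Primrec.const 2)) (Primrec.const 1)).of_eq fun x => by
      simp [Nat.testBit_eq_decide_div_mod_eq]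

theorem primrecRel_codeRel : PrimrecRel codeRel :=
  primrecRel_testBit.comp (Primrec.snd.comp (Primrec.unpair.comp Primrec.fst)) Primrec.snd

theorem primrecRel_mem_codeVal : PrimrecRel fun s p => s ∈ codeVal p :=
  primrecRel_testBit.comp (Primrec.fst.comp (Primrec.unpair.comp Primrec.fst))
    (Primrec.encode.comp Primrec.snd)

/-- A strict bound for the codes of the pairs of states at which satisfaction of a formula with
Gödel number `m` has to be tested. -/
def searchBound (m : ℕ) : ℕ :=
  Nat.pair ((4 ^ ·)^[m + 1] (m + 1)) ((4 ^ ·)^[m + 1] (m + 1))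

theorem primrec_searchBound : Primrec searchBound := by
  have htower : Primrec fun m : ℕ => (4 ^ ·)^[m + 1] (m + 1) :=
    Primrec.nat_iterate Primrec.succ Primrec.succ
      ((Primrec₂.unpaired'.1 Nat.Primrec.pow).comp (Primrec.const 4) Primrec.snd)
  exact Primrec₂.natPair.comp htower htower

theorem satisfiable_iff_exists_pair_lt {φ : Formula} : Satisfiable.{u} φ ↔
    ∃ s t, Nat.pair s t < searchBound φ.toNat ∧ (natModel codeRel codeVal).Truth s t φ := by
  constructor
  · intro h
    obtain ⟨s, hs, t, ht, hst⟩ := h.exists_code_lt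
    exact ⟨s, t, (Nat.pair_lt_pair_left t hs).trans (Nat.pair_lt_pair_right _ ht), hst⟩
  · rintro ⟨s, t, -, hst⟩
    obtain ⟨M, s, t, -, hst⟩ := exists_finite_of_natModel_truth lt_of_codeRel hst
    exact ⟨M, s, t, hst⟩

theorem computablePred_satisfiable : ComputablePred fun φ : Formula => Satisfiable.{u} φ := by
  have h : PrimrecPred fun φ : Formula => Satisfiable.{u} φ :=
    ((primrecRel_exists_truth primrecRel_codeRel lt_of_codeRel primrecRel_mem_codeVal).comp
      (primrec_searchBound.comp Formula.primrec_toNat) Primrec.id).of_eq fun _ =>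
        satisfiable_iff_exists_pair_lt.symm
  obtain ⟨hdec, h⟩ := h
  exact ⟨hdec, h.to_comp⟩

theorem computablePred_valid : ComputablePred fun φ : Formula => Valid.{u} φ := by
  have h : ComputablePred fun φ : Formula => Satisfiable.{u} φ.neg :=
    ComputablePred.computable_of_manyOneReducible
      ⟨Formula.neg, Formula.primrec_neg.to_comp, fun _ => Iff.rfl⟩ computablePred_satisfiable.{u}
  simpa only [satisfiable_neg_iff, not_not] using h.not

end LHSMinus

/-- `LHS⁻` has the finite model property (every satisfiable formula is satisfied in a finite model,
and every non-valid formula is refuted in a finite model), and its satisfiability and validity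
problems are decidable. -/
theorem mainTheorem4 :
    ((∀ φ : LHSMinus.Formula, LHSMinus.Satisfiable.{u} φ →
        ∃ (M : LHSMinus.Model.{u}) (s t : M.W), Finite M.W ∧ M.Truth s t φ) ∧
      (∀ φ : LHSMinus.Formula, ¬ LHSMinus.Valid.{u} φ →
        ∃ (M : LHSMinus.Model.{u}) (s t : M.W), Finite M.W ∧ ¬ M.Truth s t φ)) ∧
    ComputablePred (fun φ : LHSMinus.Formula => LHSMinus.Satisfiable.{u} φ) ∧
    ComputablePred (fun φ : LHSMinus.Formula => LHSMinus.Valid.{u} φ) :=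
  ⟨⟨fun _ h => h.exists_finite, fun _ h => LHSMinus.exists_finite_of_not_valid h⟩,
    LHSMinus.computablePred_satisfiable, LHSMinus.computablePred_valid⟩
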